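/- Let $X$ be a real Banach space, let $f_1,f_2:X\to\mathbb R\cup\{+\infty\}$ be proper lower semicontinuous functions, and let $x_0\in \operatorname{dom} f_1\cap\operatorname{dom} f_2$. Definitions. Write $\bar{\mathbf B}$ for the closed unit ball of a Banach space $Y$, and let $S\subset Y$ be closed and $y_0\in S$. The Clarke tangent cone $\hat T_S(y_0)$ is the set of all $v\in Y$ such that for each $\varepsilon>0$ there are $\delta>0$ and $\lambda>0$ for which $S\cap\big(y+t(v+\varepsilon\bar{\mathbf B})\big)\neq\emptyset$ for all $y\in S\cap(y_0+\delta\bar{\mathbf B})$ and all $t\in[0,\lambda]$. The Clarke normal cone is its polar, $N_S(y_0)=\{\xi\in Y^*:\langle \xi,v\rangle\le 0 \text{ for all } v\in\hat T_S(y_0)\}$. For $f:X\to\mathbb R\cup\{+\infty\}$ lower semicontinuous and finite at $x_0$, with $\operatorname{epi} f=\{(x,r)\in X\times\mathbb R: r\ge f(x)\}$, the Clarke subdifferential and the Clarke singular subdifferential are $$\partial_C f(x_0)=\{x^*\in X^*: (x^*,-1)\in N_{\operatorname{epi} f}(x_0,f(x_0))\},\qquad \partial_C^\infty f(x_0)=\{x^*\in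 X^*: (x^*,0)\in N_{\operatorname{epi} f}(x_0,f(x_0))\}.$$ A set $\Omega\subset Y$ is finite codimensional if there is $z\in\overline{\mathrm{co}}\,\Omega$ such that $L=\overline{\mathrm{span}}\,(\Omega-z)$ has finite codimension in $Y$ and $\overline{\mathrm{co}}\,(\Omega-z)$ has nonempty interior relative to $L$. The closed set $S$ is epi-Lipschitz-like at $y_0\in S$ if there are $\delta>0$, $\eta>0$ and a convex finite codimensional set $\Omega\subset Y$ such that $y+t\Omega\subset S$ for all $y\in S\cap(y_0+\delta\bar{\mathbf B})$ and all $t\in(0,\eta)$. The function $f$ is Lipschitz-like at $x_0$ if $\operatorname{epi} f$ is epi-Lipschitz-like at $(x_0,f(x_0))$. Statement. Suppose that $f_1$ is Lipschitz-like at $x_0$ and that $$\partial_C^\infty f_1(x_0)\cap\big(-\partial_C^\infty f_2(x_0)\big)=\{0\}.$$ Then $$\partial_C(f_1+f_2)(x_0)\subset\partial_C f_1(x_0)+\partial_C f_2(x_0).$$ -/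

import Mathlib

open scoped Pointwise

/-- The Clarke tangent cone to `S` at `x₀`: the vectors `v` such that for every `ε > 0` there are
`δ > 0` and `l > 0` such that `S ∩ (x + t (v + ε B))` is nonempty, `B` being the closed unit ball,
for all `x ∈ S ∩ (x₀ + δ B)` and all `t ∈ [0, l]`. -/
def clarkeTangentCone {E : Type*} [NormedAddCommGroup E] [NormedSpace ℝ E]
    (S : Set E) (x₀ : E) : Set E :=
  {v | ∀ ε > (0 : ℝ), ∃ δ > (0 : ℝ), ∃ l > (0 : ℝ),
    ∀ x ∈ S ∩ Metric.closedBall x₀ δ, ∀ t ∈ Set.Icc (0 : ℝ) l,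
      ∃ w ∈ Metric.closedBall v ε, x + t • w ∈ S}

/-- The Clarke normal cone to `S` at `x₀`: the (negative) polar of the Clarke tangent cone. -/
def clarkeNormalCone {E : Type*} [NormedAddCommGroup E] [NormedSpace ℝ E]
    (S : Set E) (x₀ : E) : Set (StrongDual ℝ E) :=
  {ξ | ∀ v ∈ clarkeTangentCone S x₀, ξ v ≤ 0}

/-- `S` is finite codimensional: for some `x₀` in its closed convex hull, the closed span of
`S - x₀` has finite codimension, and the closed convex hull of `S - x₀` has nonempty interior
relative to that subspace. -/
def IsFiniteCodimensional {E : Type*} [NormedAddCommGroup E] [NormedSpace ℝ E]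
    (S : Set E) : Prop :=
  ∃ x₀ ∈ closedConvexHull ℝ S, ∃ L : Submodule ℝ E,
    L = (Submodule.span ℝ ((fun x => x - x₀) '' S)).topologicalClosure ∧
    FiniteDimensional ℝ (E ⧸ L) ∧
    (interior {u : L | (u : E) ∈ closedConvexHull ℝ ((fun x => x - x₀) '' S)}).Nonempty

/-- `S` is epi-Lipschitz-like at `x₀`; the notion is used for closed `S` and `x₀ ∈ S`. -/
def IsEpiLipschitzLikeAt {E : Type*} [NormedAddCommGroup E] [NormedSpace ℝ E]
    (S : Set E) (x₀ : E) : Prop :=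
  ∃ δ > (0 : ℝ), ∃ Ω : Set E, Convex ℝ Ω ∧ IsFiniteCodimensional Ω ∧ ∃ η > (0 : ℝ),
    ∀ y ∈ Metric.closedBall x₀ δ ∩ S, ∀ t ∈ Set.Ioo (0 : ℝ) η, ∀ ω ∈ Ω, y + t • ω ∈ S

/-- The epigraph of an extended-real-valued function, as a subset of `X × ℝ`. -/
def epi {X : Type*} (f : X → EReal) : Set (X × ℝ) :=
  {p | f p.1 ≤ (p.2 : EReal)}

/-- The functional `(v, r) ↦ x' v + s * r` on `X × ℝ`, that is, the pair `(x', s)` of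
`X* × ℝ = (X × ℝ)*`. -/
noncomputable def dualPair {X : Type*} [NormedAddCommGroup X] [NormedSpace ℝ X]
    (x' : StrongDual ℝ X) (s : ℝ) : StrongDual ℝ (X × ℝ) :=
  x'.coprod (s • ContinuousLinearMap.id ℝ ℝ)

/-- `f` is Lipschitz-like at `x₀` (a point where `f` is finite): its epigraph is
epi-Lipschitz-like at `(x₀, f x₀)`. -/
def IsLipschitzLikeAt {X : Type*} [NormedAddCommGroup X] [NormedSpace ℝ X]
    (f : X → EReal) (x₀ : X) : Prop :=
  IsEpiLipschitzLikeAt (epi f) (x₀, (f x₀).toReal)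

/-- The Clarke subdifferential of `f` at a point `x₀` where `f` is finite. -/
def clarkeSubdifferential {X : Type*} [NormedAddCommGroup X] [NormedSpace ℝ X]
    (f : X → EReal) (x₀ : X) : Set (StrongDual ℝ X) :=
  {x' | dualPair x' (-1) ∈ clarkeNormalCone (epi f) (x₀, (f x₀).toReal)}

/-- The Clarke singular subdifferential of `f` at a point `x₀` where `f` is finite. -/
def clarkeSingularSubdifferential {X : Type*} [NormedAddCommGroup X] [NormedSpace ℝ X]
    (f : X → EReal) (x₀ : X) : Set (StrongDual ℝ X) :=
  {x' | dualPair x' 0 ∈ clarkeNormalCone (epi f) (x₀, (f x₀).toReal)}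

/-!
The proof is primal: the sum rule is derived from an inclusion between tangent cones, and normals
enter only through the Hahn-Banach theorem.

Let `T₁`, `T₂` be the Clarke tangent cones to the epigraphs of `f₁`, `f₂`, let
`C = epi f₁ × epi f₂`, and let `G ((x, r), (y, s)) = x - y` (`baseDiff`). The epigraph of `f₁ + f₂`
is the image of `C ∩ ker G` under addition of the last coordinates, so two facts are needed.

* Tangent vectors in `(T₁ × T₂) ∩ ker G` are tangent to `C ∩ ker G`.
* A functional that is nonpositive on `(T₁ × T₂) ∩ ker G` is the sum of one that is nonpositive on
  `T₁ × T₂` and one of the form `φ ∘ G` (Farkas' lemma,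
  `PointedCone.exists_le_comp_of_nonpos_on_ker`). Applied to `(x', -1, -1)`, this gives the
  decomposition `x' = (x' - φ) + φ`.

Both rest on one open mapping theorem, `IsUniformlyTangent.exists_preimage`. It asks for a bounded
set `D` of directions that are tangent to `C` *uniformly* and whose images under `G` approximate
all vectors of the unit ball. A step along `D` of length `‖y - G c‖` then halves the residual of the
equation `G c = y`, and the steps add up to a convergent series in `C`. For `C` itself this gives the
first fact; for the closed cone `T₁ × T₂`, to which each of its subsets is uniformly tangent, it
gives the bounded preimages that Farkas' lemma requires.

The set `D` comes from the two hypotheses (`exists_isUniformlyTangent_epi_prod`). The convex set `Ω`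
of the epi-Lipschitz-like property is uniformly tangent to `epi f₁`, and its closure contains a
translate of a ball of a closed subspace `L` of finite codimension. Since the unit ball is totally
bounded modulo `L`, what is missing is the approximation of finitely many vectors. By the
qualification condition the projections of `T₁` and `T₂` to `X` have a dense difference
(`dense_baseDiff_clarkeTangentCone`), so finitely many tangent vectors suffice, and a finite set of
tangent vectors is uniformly tangent.
-/

/-! ### Uniformly tangent sets -/

section UniformlyTangent

variable {E : Type*} [NormedAddCommGroup E] [NormedSpace ℝ E]
  {F : Type*} [NormedAddCommGroup F] [NormedSpace ℝ F]
  {S D D₁ D₂ : Set E} {x₀ v : E}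

/-- `D` is uniformly tangent to `S` at `x₀`: every `v ∈ D` satisfies the definition of a Clarke
tangent vector, with the numbers `δ` and `l` depending on `ε` only and not on `v`. -/
def IsUniformlyTangent (D S : Set E) (x₀ : E) : Prop :=
  ∀ ε > (0 : ℝ), ∃ δ > (0 : ℝ), ∃ l > (0 : ℝ), ∀ d ∈ D,
    ∀ x ∈ S ∩ Metric.closedBall x₀ δ, ∀ t ∈ Set.Icc (0 : ℝ) l,
      ∃ w ∈ Metric.closedBall d ε, x + t • w ∈ S

lemma mem_clarkeTangentCone_iff :
    v ∈ clarkeTangentCone S x₀ ↔ IsUniformlyTangent {v} S x₀ := by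
  simp [clarkeTangentCone, IsUniformlyTangent]

lemma IsUniformlyTangent.union (h₁ : IsUniformlyTangent D₁ S x₀)
    (h₂ : IsUniformlyTangent D₂ S x₀) : IsUniformlyTangent (D₁ ∪ D₂) S x₀ := by
  intro ε hε
  obtain ⟨δ₁, hδ₁, l₁, hl₁, H₁⟩ := h₁ ε hε
  obtain ⟨δ₂, hδ₂, l₂, hl₂, H₂⟩ := h₂ ε hε
  refine ⟨min δ₁ δ₂, lt_min hδ₁ hδ₂, min l₁ l₂, lt_min hl₁ hl₂, ?_⟩
  rintro d (hd | hd) x ⟨hxS, hx⟩ t ⟨ht0, ht⟩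
  · exact H₁ d hd x ⟨hxS, Metric.closedBall_subset_closedBall (min_le_left _ _) hx⟩ t
      ⟨ht0, ht.trans (min_le_left _ _)⟩
  · exact H₂ d hd x ⟨hxS, Metric.closedBall_subset_closedBall (min_le_right _ _) hx⟩ t
      ⟨ht0, ht.trans (min_le_right _ _)⟩

lemma isUniformlyTangent_of_finite (hD : D.Finite) (h : D ⊆ clarkeTangentCone S x₀) :
    IsUniformlyTangent D S x₀ := by
  induction D, hD using Set.Finite.induction_on with
  | empty => exact fun ε _ => ⟨1, one_pos, 1, one_pos, by simp⟩
  | insert _ _ ih =>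
    rw [Set.insert_subset_iff] at h
    rw [Set.insert_eq]
    exact (mem_clarkeTangentCone_iff.1 h.1).union (ih h.2)

lemma IsUniformlyTangent.closure (h : IsUniformlyTangent D S x₀) :
    IsUniformlyTangent (closure D) S x₀ := by
  intro ε hε
  obtain ⟨δ, hδ, l, hl, H⟩ := h (ε / 2) (half_pos hε)
  refine ⟨δ, hδ, l, hl, fun d hd x hx t ht => ?_⟩
  obtain ⟨d', hd', hdd'⟩ := Metric.mem_closure_iff.1 hd (ε / 2) (half_pos hε)
  obtain ⟨w, hw, hwS⟩ := H d' hd' x hx t ht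
  refine ⟨w, ?_, hwS⟩
  rw [Metric.mem_closedBall] at hw ⊢
  linarith [dist_triangle w d' d, dist_comm d d']

lemma IsUniformlyTangent.mono (h : IsUniformlyTangent D₂ S x₀) (hD : D₁ ⊆ D₂) :
    IsUniformlyTangent D₁ S x₀ := by
  intro ε hε
  obtain ⟨δ, hδ, l, hl, H⟩ := h ε hε
  exact ⟨δ, hδ, l, hl, fun d hd => H d (hD hd)⟩

lemma IsUniformlyTangent.subset_clarkeTangentCone (h : IsUniformlyTangent D S x₀) :
    D ⊆ clarkeTangentCone S x₀ := fun _ hv =>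
  mem_clarkeTangentCone_iff.2 (h.mono (Set.singleton_subset_iff.2 hv))

/-- A step along `D₁` of length controlled by the bound on `D₁` stays close to `x₀`, so that it can
be followed by a step along `D₂`. -/
lemma IsUniformlyTangent.add (h₁ : IsUniformlyTangent D₁ S x₀)
    (h₂ : IsUniformlyTangent D₂ S x₀) (hD₁ : Bornology.IsBounded D₁) :
    IsUniformlyTangent (D₁ + D₂) S x₀ := by
  intro ε hε
  obtain ⟨R, hR, hD⟩ := hD₁.exists_pos_norm_le
  obtain ⟨δ₁, hδ₁, l₁, hl₁, H₁⟩ := h₁ (ε / 2) (half_pos hε)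
  obtain ⟨δ₂, hδ₂, l₂, hl₂, H₂⟩ := h₂ (ε / 2) (half_pos hε)
  have hRε : 0 < 2 * (R + ε) := by positivity
  refine ⟨min δ₁ (δ₂ / 2), by positivity, min l₁ (min l₂ (δ₂ / (2 * (R + ε)))),
    by positivity, ?_⟩
  rintro _ ⟨d₁, hd₁, d₂, hd₂, rfl⟩ x ⟨hxS, hx⟩ t ⟨ht0, ht⟩
  rw [Metric.mem_closedBall, le_min_iff] at hx
  rw [le_min_iff, le_min_iff, le_div_iff₀ hRε] at ht
  obtain ⟨w₁, hw₁, hw₁S⟩ := H₁ d₁ hd₁ x ⟨hxS, hx.1⟩ t ⟨ht0, ht.1⟩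
  have hw₁' : ‖w₁‖ ≤ R + ε := by
    rw [mem_closedBall_iff_norm] at hw₁
    linarith [norm_le_norm_add_norm_sub' w₁ d₁, hD d₁ hd₁]
  have hball : x + t • w₁ ∈ Metric.closedBall x₀ δ₂ := by
    rw [mem_closedBall_iff_norm, add_sub_right_comm]
    have h1 := norm_add_le (x - x₀) (t • w₁)
    rw [norm_smul, Real.norm_of_nonneg ht0, ← dist_eq_norm] at h1
    have h2 := mul_le_mul_of_nonneg_left hw₁' ht0
    linarith [hx.2, ht.2.2]
  obtain ⟨w₂, hw₂, hw₂S⟩ := H₂ d₂ hd₂ _ ⟨hw₁S, hball⟩ t ⟨ht0, ht.2.1⟩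
  refine ⟨w₁ + w₂, ?_, by rwa [smul_add, ← add_assoc]⟩
  rw [Metric.mem_closedBall] at *
  linarith [dist_add_add_le w₁ w₂ d₁ d₂]

lemma IsUniformlyTangent.smul (h : IsUniformlyTangent D S x₀) {c : ℝ} (hc : 0 ≤ c) :
    IsUniformlyTangent (c • D) S x₀ := by
  intro ε hε
  rcases hc.eq_or_lt with rfl | hc
  · refine ⟨1, one_pos, 1, one_pos, ?_⟩
    rintro _ ⟨d, -, rfl⟩ x hx t -
    exact ⟨0, by simpa using hε.le, by simpa using hx.1⟩
  obtain ⟨δ, hδ, l, hl, H⟩ := h (ε / c) (by positivity)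
  refine ⟨δ, hδ, l / c, by positivity, ?_⟩
  rintro _ ⟨d, hd, rfl⟩ x hx t ⟨ht0, ht⟩
  rw [le_div_iff₀ hc] at ht
  obtain ⟨w, hw, hwS⟩ := H d hd x hx (t * c) ⟨by positivity, ht⟩
  refine ⟨c • w, ?_, by rwa [smul_smul]⟩
  rw [Metric.mem_closedBall, le_div_iff₀ hc] at hw
  rw [Metric.mem_closedBall, dist_smul₀, Real.norm_of_nonneg hc.le]
  linarith

lemma IsUniformlyTangent.prod {S' D' : Set F} {y₀ : F} (h : IsUniformlyTangent D S x₀)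
    (h' : IsUniformlyTangent D' S' y₀) :
    IsUniformlyTangent (D ×ˢ D') (S ×ˢ S') (x₀, y₀) := by
  intro ε hε
  obtain ⟨δ₁, hδ₁, l₁, hl₁, H₁⟩ := h ε hε
  obtain ⟨δ₂, hδ₂, l₂, hl₂, H₂⟩ := h' ε hε
  refine ⟨min δ₁ δ₂, by positivity, min l₁ l₂, by positivity, ?_⟩
  rintro ⟨d, d'⟩ ⟨hd, hd'⟩ ⟨x, y⟩ ⟨⟨hxS, hyS⟩, hxy⟩ t ⟨ht0, ht⟩
  rw [Metric.mem_closedBall, Prod.dist_eq, max_le_iff, le_min_iff, le_min_iff] at hxy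
  rw [le_min_iff] at ht
  obtain ⟨w, hw, hwS⟩ := H₁ d hd x ⟨hxS, hxy.1.1⟩ t ⟨ht0, ht.1⟩
  obtain ⟨w', hw', hwS'⟩ := H₂ d' hd' y ⟨hyS, hxy.2.2⟩ t ⟨ht0, ht.2⟩
  exact ⟨(w, w'), by rw [← closedBall_prod_same]; exact ⟨hw, hw'⟩, hwS, hwS'⟩

lemma IsUniformlyTangent.of_convexCone {T : PointedCone ℝ E} (hD : D ⊆ T) (x₀ : E) :
    IsUniformlyTangent D T x₀ := fun _ hε =>
  ⟨1, one_pos, 1, one_pos, fun d hd _ hx _ ht => ⟨d, Metric.mem_closedBall_self hε.le,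
    T.add_mem hx.1 (T.smul_mem ht.1 (hD hd))⟩⟩

/-- The Clarke tangent cone, as a convex cone. -/
def clarkeTangentPointedCone (S : Set E) (x₀ : E) : PointedCone ℝ E where
  carrier := clarkeTangentCone S x₀
  zero_mem' := fun ε hε => ⟨1, one_pos, 1, one_pos, fun x hx t _ =>
    ⟨0, Metric.mem_closedBall_self hε.le, by simpa using hx.1⟩⟩
  add_mem' := fun {v w} hv hw => by
    rw [mem_clarkeTangentCone_iff] at *
    rw [← Set.singleton_add_singleton]
    exact hv.add hw Bornology.isBounded_singleton
  smul_mem' := fun c v hv => by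
    rw [mem_clarkeTangentCone_iff] at *
    have := hv.smul c.2
    rwa [Set.smul_set_singleton] at this

lemma isClosed_clarkeTangentCone (S : Set E) (x₀ : E) : IsClosed (clarkeTangentCone S x₀) := by
  refine isClosed_of_closure_subset fun v hv ε hε => ?_
  obtain ⟨v', hv', hvv'⟩ := Metric.mem_closure_iff.1 hv (ε / 2) (half_pos hε)
  obtain ⟨δ, hδ, l, hl, H⟩ := hv' (ε / 2) (half_pos hε)
  refine ⟨δ, hδ, l, hl, fun x hx t ht => ?_⟩
  obtain ⟨w, hw, hwS⟩ := H x hx t ht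
  refine ⟨w, ?_, hwS⟩
  rw [Metric.mem_closedBall] at hw ⊢
  linarith [dist_triangle w v' v, dist_comm v v']

end UniformlyTangent

/-! ### An open mapping theorem along a closed set -/

section OpenMapping

variable {X : Type*} [NormedAddCommGroup X] [NormedSpace ℝ X]
  {Y : Type*} [NormedAddCommGroup Y] [NormedSpace ℝ Y]
  {G : Y →L[ℝ] X} {C D : Set Y} {c₀ : Y}

/-- One step of the iteration: because `D` is *uniformly* tangent, a step of full length
`‖y - G c‖` in a direction that `G` maps close to `y - G c` is available, and it halves the
residual. -/
lemma IsUniformlyTangent.exists_step (hD : IsUniformlyTangent D C c₀)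
    (hb : Bornology.IsBounded D) (hcov : ∀ u : X, ‖u‖ ≤ 1 → ∃ d ∈ D, ‖u - G d‖ ≤ 1 / 4) :
    ∃ δ > (0 : ℝ), ∃ M > (0 : ℝ), ∀ c ∈ C ∩ Metric.closedBall c₀ δ, ∀ y, ‖y - G c‖ ≤ δ →
      ∃ c' ∈ C, ‖c' - c‖ ≤ M * ‖y - G c‖ ∧ ‖y - G c'‖ ≤ ‖y - G c‖ / 2 := by
  obtain ⟨R, hR, hDR⟩ := hb.exists_pos_norm_le
  -- a direction within `ε` of `D` changes its image under `G` by at most `1 / 4`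
  set ε : ℝ := 1 / (4 * (‖G‖ + 1)) with hεdef
  have hε : 0 < ε := by positivity
  have hGε : ‖G‖ * ε ≤ 1 / 4 := by
    rw [hεdef, mul_one_div, div_le_div_iff₀ (by positivity) (by positivity)]
    linarith
  obtain ⟨δ, hδ, l, hl, H⟩ := hD ε hε
  refine ⟨min δ l, by positivity, R + ε, by positivity, ?_⟩
  rintro c ⟨hcC, hc⟩ y hy
  set e : ℝ := ‖y - G c‖ with he
  have he0 : 0 ≤ e := norm_nonneg _
  have hu : ‖e⁻¹ • (y - G c)‖ ≤ 1 := by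
    rw [norm_smul, norm_inv, Real.norm_of_nonneg he0]
    exact inv_mul_le_one
  have heu : e • e⁻¹ • (y - G c) = y - G c := by
    rcases eq_or_ne e 0 with h0 | h0
    · rw [h0, zero_smul, eq_comm, ← norm_eq_zero, ← he, h0]
    · exact smul_inv_smul₀ h0 _
  obtain ⟨d, hdD, hd⟩ := hcov _ hu
  obtain ⟨w, hw, hwC⟩ := H d hdD c
    ⟨hcC, Metric.closedBall_subset_closedBall (min_le_left _ _) hc⟩ e
    ⟨he0, hy.trans (min_le_right _ _)⟩
  rw [mem_closedBall_iff_norm] at hw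
  refine ⟨_, hwC, ?_, ?_⟩
  · rw [add_sub_cancel_left, norm_smul, Real.norm_of_nonneg he0, mul_comm]
    have := norm_le_norm_add_norm_sub' w d
    gcongr
    linarith [hDR d hdD]
  · have key : y - G (c + e • w) = e • ((e⁻¹ • (y - G c) - G d) - G (w - d)) := by
      rw [smul_sub, smul_sub, heu]
      simp only [map_add, map_smul, map_sub, smul_sub]
      abel
    have hG : ‖G (w - d)‖ ≤ 1 / 4 :=
      ((G.le_opNorm _).trans (mul_le_mul_of_nonneg_left hw (norm_nonneg _))).trans hGε
    rw [key, norm_smul, Real.norm_of_nonneg he0, div_eq_mul_one_div]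
    gcongr
    linarith [norm_sub_le (e⁻¹ • (y - G c) - G d) (G (w - d))]

/-- Metric regularity of `G` along the closed set `C`, near `c₀`: if `C` has a bounded uniformly
tangent set whose image under `G` approximates the unit ball, then the equation `G c' = y` has a
solution `c' ∈ C` at a distance from `c ∈ C` that is linear in the residual `y - G c`. For
`C = Y` this is the open mapping theorem. -/
theorem IsUniformlyTangent.exists_preimage [CompleteSpace Y] (hC : IsClosed C)
    (hD : IsUniformlyTangent D C c₀) (hb : Bornology.IsBounded D)
    (hcov : ∀ u : X, ‖u‖ ≤ 1 → ∃ d ∈ D, ‖u - G d‖ ≤ 1 / 4) :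
    ∃ δ > (0 : ℝ), ∃ M > (0 : ℝ), ∀ c ∈ C ∩ Metric.closedBall c₀ δ, ∀ y, ‖y - G c‖ ≤ δ →
      ∃ c' ∈ C, G c' = y ∧ ‖c' - c‖ ≤ M * ‖y - G c‖ := by
  obtain ⟨δ, hδ, M, hM, H⟩ := hD.exists_step hb hcov
  -- the whole iteration moves `c` by at most `2 M ‖y - G c‖`, which has to stay below `δ / 2`
  refine ⟨min (δ / 2) (δ / (4 * M)), by positivity, 2 * M, by positivity, ?_⟩
  rintro c ⟨hcC, hc⟩ y hy
  rw [Metric.mem_closedBall, le_min_iff] at hc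
  rw [le_min_iff, le_div_iff₀ (show 0 < 4 * M by positivity)] at hy
  set e : ℝ := ‖y - G c‖ with he
  have he0 : 0 ≤ e := norm_nonneg _
  -- invariant of the iteration: distance travelled and residual after `n` steps
  let P : ℕ → Y → Prop := fun n z =>
    z ∈ C ∧ dist z c ≤ 2 * M * e * (1 - (1 / 2) ^ n) ∧ ‖y - G z‖ ≤ e * (1 / 2) ^ n
  have step : ∀ n z, P n z → ∃ z', P (n + 1) z' ∧ dist z z' ≤ 2 * M * e / 2 / 2 ^ n := by
    rintro n z ⟨hzC, hzc, hze⟩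
    have hp : (0 : ℝ) < (1 / 2) ^ n := by positivity
    have hp1 : (1 / 2 : ℝ) ^ n ≤ 1 := pow_le_one₀ (by norm_num) (by norm_num)
    have hMe : 0 ≤ M * e := by positivity
    obtain ⟨z', hz'C, hzz', hz'e⟩ := H z ⟨hzC, by
      rw [Metric.mem_closedBall]
      linarith [dist_triangle z c c₀, hc.1, hy.2, mul_nonneg hMe hp.le]⟩ y
      (hze.trans ((mul_le_of_le_one_right he0 hp1).trans (by linarith [hy.1])))
    have hd : dist z' z ≤ M * e * (1 / 2) ^ n := by
      rw [dist_eq_norm, mul_assoc]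
      exact hzz'.trans (mul_le_mul_of_nonneg_left hze hM.le)
    refine ⟨z', ⟨hz'C, ?_, ?_⟩, ?_⟩
    · rw [pow_succ]
      linarith [dist_triangle z' z c]
    · rw [pow_succ]
      linarith
    · rw [dist_comm]
      convert hd using 1
      rw [one_div, inv_pow]
      field_simp
  choose! s hs using step
  let z : ℕ → Y := fun n => Nat.rec c s n
  have hz : ∀ n, P n (z n) := by
    intro n
    induction n with
    | zero => exact ⟨hcC, by simp [z], by simp [z, he]⟩
    | succ n ih => exact (hs n _ ih).1
  have hdist : ∀ n, dist (z n) (z (n + 1)) ≤ 2 * M * e / 2 / 2 ^ n := fun n => (hs n _ (hz n)).2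
  obtain ⟨a, ha⟩ := cauchySeq_tendsto_of_complete (cauchySeq_of_le_geometric_two hdist)
  refine ⟨a, hC.mem_of_tendsto ha (Filter.Eventually.of_forall fun n => (hz n).1), ?_, ?_⟩
  · have h1 : Filter.Tendsto (fun n => ‖y - G (z n)‖) Filter.atTop (nhds ‖y - G a‖) :=
      (tendsto_const_nhds.sub ((G.continuous.tendsto a).comp ha)).norm
    have h2 : Filter.Tendsto (fun n : ℕ => e * (1 / 2 : ℝ) ^ n) Filter.atTop (nhds 0) := by
      simpa using (tendsto_pow_atTop_nhds_zero_of_lt_one (r := (1 / 2 : ℝ))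
        (by norm_num) (by norm_num)).const_mul e
    have h3 := le_of_tendsto_of_tendsto' h1 h2 fun n => (hz n).2.2
    rw [norm_le_zero_iff, sub_eq_zero] at h3
    exact h3.symm
  · rw [← dist_eq_norm, dist_comm]
    exact dist_le_of_le_geometric_two_of_tendsto₀ hdist ha

/-- Clarke tangent vectors to `C` that lie in the kernel of `G` are tangent to `C ∩ ker G`: the
approximating points of `C` are moved into `ker G` by metric regularity. -/
theorem IsUniformlyTangent.mem_clarkeTangentCone_inter_ker [CompleteSpace Y] (hC : IsClosed C)
    (hD : IsUniformlyTangent D C c₀) (hb : Bornology.IsBounded D)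
    (hcov : ∀ u : X, ‖u‖ ≤ 1 → ∃ d ∈ D, ‖u - G d‖ ≤ 1 / 4)
    {v : Y} (hv : v ∈ clarkeTangentCone C c₀) (hGv : G v = 0) :
    v ∈ clarkeTangentCone (C ∩ {c | G c = 0}) c₀ := by
  obtain ⟨δ, hδ, M, hM, H⟩ := hD.exists_preimage hC hb hcov
  intro ε hε
  -- the correction into `ker G` perturbs the direction by at most `M ‖G‖ ε'`
  set ε' : ℝ := min 1 (ε / (1 + M * ‖G‖)) with hε'
  have hε'0 : 0 < ε' := by positivity
  have hε'ε : (1 + M * ‖G‖) * ε' ≤ ε := by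
    rw [mul_comm, ← le_div_iff₀ (by positivity)]
    exact min_le_right _ _
  obtain ⟨δ₁, hδ₁, l₁, hl₁, H₁⟩ := hv ε' hε'0
  refine ⟨min δ₁ (δ / 2), by positivity,
    min l₁ (min (δ / (2 * (‖v‖ + 1))) (δ / (‖G‖ + 1))), by positivity, ?_⟩
  rintro x ⟨⟨hxC, hxG⟩, hx⟩ t ⟨ht0, ht⟩
  rw [Metric.mem_closedBall, le_min_iff] at hx
  rw [le_min_iff, le_min_iff, le_div_iff₀ (by positivity), le_div_iff₀ (by positivity)] at ht
  obtain ⟨w, hw, hwC⟩ := H₁ x ⟨hxC, hx.1⟩ t ⟨ht0, ht.1⟩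
  rw [mem_closedBall_iff_norm] at hw
  rcases ht0.eq_or_lt with rfl | ht0'
  · exact ⟨v, Metric.mem_closedBall_self hε.le, by simpa using ⟨hxC, hxG⟩⟩
  have hwn : ‖w‖ ≤ ‖v‖ + 1 := by
    linarith [norm_le_norm_add_norm_sub' w v, min_le_left 1 (ε / (1 + M * ‖G‖))]
  have hGx : G x = 0 := hxG
  have hres : ‖0 - G (x + t • w)‖ ≤ t * (‖G‖ * ε') := by
    have : 0 - G (x + t • w) = -(t • G (w - v)) := by
      rw [map_add, map_smul, map_sub, hGx, hGv]; simp
    rw [this, norm_neg, norm_smul, Real.norm_of_nonneg ht0]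
    gcongr
    exact (G.le_opNorm _).trans (mul_le_mul_of_nonneg_left hw (norm_nonneg _))
  have hball : x + t • w ∈ Metric.closedBall c₀ δ := by
    rw [mem_closedBall_iff_norm, add_sub_right_comm]
    have h1 := norm_add_le (x - c₀) (t • w)
    rw [norm_smul, Real.norm_of_nonneg ht0, ← dist_eq_norm] at h1
    have h2 := mul_le_mul_of_nonneg_left hwn ht0
    linarith [hx.2, ht.2.1]
  obtain ⟨c', hc'C, hc'G, hc'⟩ := H _ ⟨hwC, hball⟩ 0 (hres.trans (by
    have h1 : ‖G‖ * ε' ≤ ‖G‖ + 1 := by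
      have := mul_le_mul_of_nonneg_left (min_le_left 1 (ε / (1 + M * ‖G‖))) (norm_nonneg G)
      linarith
    exact (mul_le_mul_of_nonneg_left h1 ht0).trans ht.2.2))
  have hx' : x + t • (t⁻¹ • (c' - x)) = c' := by
    rw [smul_inv_smul₀ ht0'.ne']; abel
  refine ⟨t⁻¹ • (c' - x), ?_, by rw [hx']; exact ⟨hc'C, hc'G⟩⟩
  rw [mem_closedBall_iff_norm]
  have hsplit : t⁻¹ • (c' - x) - v = t⁻¹ • (c' - (x + t • w)) + (w - v) := by
    rw [← sub_sub, smul_sub t⁻¹ (c' - x), inv_smul_smul₀ ht0'.ne']; abel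
  have h1 : ‖t⁻¹ • (c' - (x + t • w))‖ ≤ M * (‖G‖ * ε') := by
    rw [norm_smul, norm_inv, Real.norm_of_nonneg ht0, inv_mul_le_iff₀ ht0']
    refine hc'.trans ((mul_le_mul_of_nonneg_left hres hM.le).trans (le_of_eq ?_))
    ring
  rw [hsplit]
  have h2 := norm_add_le (t⁻¹ • (c' - (x + t • w))) (w - v)
  nlinarith

end OpenMapping

/-! ### Duality for convex cones -/

section Duality

variable {X : Type*} [NormedAddCommGroup X] [NormedSpace ℝ X]
  {Y : Type*} [NormedAddCommGroup Y] [NormedSpace ℝ Y]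

/-- A closed convex cone `T` containing a bounded set `D` whose image under `G` approximates the
unit ball is mapped onto the whole space, with bounded preimages. The cone is a closed set to which
`D` is uniformly tangent at `0`, so that metric regularity applies. -/
theorem PointedCone.exists_preimage_norm_le [CompleteSpace Y] {G : Y →L[ℝ] X}
    {T : PointedCone ℝ Y} (hT : IsClosed (T : Set Y)) {D : Set Y} (hDT : D ⊆ T)
    (hb : Bornology.IsBounded D) (hcov : ∀ u : X, ‖u‖ ≤ 1 → ∃ d ∈ D, ‖u - G d‖ ≤ 1 / 4) :
    ∃ M : ℝ, ∀ u : X, ∃ t ∈ T, G t = u ∧ ‖t‖ ≤ M * ‖u‖ := by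
  obtain ⟨δ, hδ, M, -, H⟩ :=
    (IsUniformlyTangent.of_convexCone hDT 0).exists_preimage hT hb hcov
  refine ⟨M, fun u => ?_⟩
  have hs : 0 < δ / (‖u‖ + 1) := by positivity
  set s : ℝ := δ / (‖u‖ + 1) with hsdef
  have hsu : ‖s • u‖ = s * ‖u‖ := by rw [norm_smul, Real.norm_of_nonneg hs.le]
  obtain ⟨t, htT, htG, ht⟩ := H 0 ⟨T.zero_mem, Metric.mem_closedBall_self hδ.le⟩ (s • u) (by
    rw [map_zero, sub_zero, hsu, hsdef, div_mul_eq_mul_div, div_le_iff₀ (by positivity)]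
    nlinarith [norm_nonneg u])
  rw [map_zero, sub_zero, sub_zero, hsu] at ht
  refine ⟨s⁻¹ • t, T.smul_mem (by positivity) htT, ?_, ?_⟩
  · rw [map_smul, htG, inv_smul_smul₀ hs.ne']
  · rw [norm_smul, norm_inv, Real.norm_of_nonneg hs.le, inv_mul_le_iff₀ hs]
    linarith

/-- Farkas' lemma for a map that sends the cone `T` onto the whole space with bounded preimages: a
functional that is nonpositive on `T ∩ ker G` is dominated on `T` by some `φ ∘ G`. The functional
`-φ` is obtained from the Hahn-Banach theorem, below the value function
`u ↦ inf {-ξ t | t ∈ T, G t = u}`, which is sublinear. -/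
theorem PointedCone.exists_le_comp_of_nonpos_on_ker {G : Y →L[ℝ] X} {T : PointedCone ℝ Y} {M : ℝ}
    (hM : ∀ u : X, ∃ t ∈ T, G t = u ∧ ‖t‖ ≤ M * ‖u‖) {ξ : StrongDual ℝ Y}
    (hξ : ∀ t ∈ T, G t = 0 → ξ t ≤ 0) :
    ∃ φ : StrongDual ℝ X, ∀ t ∈ T, ξ t ≤ φ (G t) := by
  let A : X → Set ℝ := fun u => (fun t => -ξ t) '' {t | t ∈ T ∧ G t = u}
  have hne : ∀ u, (A u).Nonempty := fun u => by
    obtain ⟨t, ht, htu, -⟩ := hM u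
    exact ⟨_, t, ⟨ht, htu⟩, rfl⟩
  -- the infimum is finite: a preimage of `-u` in `T` bounds the values at all preimages of `u`
  have hbdd : ∀ u, BddBelow (A u) := fun u => by
    obtain ⟨t', ht', htu', -⟩ := hM (-u)
    refine ⟨ξ t', ?_⟩
    rintro _ ⟨t, ⟨ht, htu⟩, rfl⟩
    have := hξ (t + t') (T.add_mem ht ht') (by rw [map_add, htu, htu', add_neg_cancel])
    rw [map_add] at this
    dsimp only
    linarith
  let N : X → ℝ := fun u => sInf (A u)
  have hN : ∀ t ∈ T, N (G t) ≤ -ξ t := fun t ht => csInf_le (hbdd _) ⟨t, ⟨ht, rfl⟩, rfl⟩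
  have hsmul : ∀ c : ℝ, 0 < c → ∀ u, N (c • u) ≤ c * N u := by
    intro c hc u
    rw [← inv_mul_le_iff₀ hc]
    refine le_csInf (hne u) ?_
    rintro _ ⟨t, ⟨ht, rfl⟩, rfl⟩
    rw [inv_mul_le_iff₀ hc, ← map_smul]
    refine (hN _ (T.smul_mem hc.le ht)).trans (le_of_eq ?_)
    change -ξ (c • t) = _
    rw [map_smul, smul_eq_mul, mul_neg]
  have hadd : ∀ u v, N (u + v) ≤ N u + N v := by
    intro u v
    rw [← sub_le_iff_le_add]
    refine le_csInf (hne u) ?_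
    rintro _ ⟨t, ⟨ht, rfl⟩, rfl⟩
    rw [sub_le_comm]
    refine le_csInf (hne v) ?_
    rintro _ ⟨s, ⟨hs, rfl⟩, rfl⟩
    have := hN _ (T.add_mem ht hs)
    rw [map_add, map_add] at this
    linarith
  obtain ⟨g, -, hg⟩ := exists_extension_of_le_sublinear (⊥ : X →ₗ.[ℝ] ℝ) N
    (fun c hc u => (hsmul c hc u).antisymm (by
      have := hsmul c⁻¹ (inv_pos.2 hc) (c • u)
      rwa [inv_smul_smul₀ hc.ne', le_inv_mul_iff₀ hc] at this))
    hadd (by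
      rintro ⟨x, hx⟩
      obtain rfl : x = 0 := (Submodule.mem_bot ℝ).1 hx
      rw [show (⊥ : X →ₗ.[ℝ] ℝ) ⟨0, hx⟩ = 0 from LinearPMap.map_zero _]
      refine le_csInf (hne 0) ?_
      rintro _ ⟨t, ⟨ht, ht0⟩, rfl⟩
      have := hξ t ht ht0
      dsimp only
      linarith)
  have hbound : ∀ u, g u ≤ ‖ξ‖ * M * ‖u‖ := by
    intro u
    obtain ⟨t, ht, rfl, htM⟩ := hM u
    have h1 := (hg _).trans (hN t ht)
    have h2 := neg_le_of_abs_le (ξ.le_opNorm t)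
    have h3 := mul_le_mul_of_nonneg_left htM (norm_nonneg ξ)
    linarith
  let ψ : StrongDual ℝ X := g.mkContinuous (‖ξ‖ * M) (fun u => by
    rw [Real.norm_eq_abs, abs_le]
    have := hbound (-u)
    rw [map_neg, norm_neg] at this
    exact ⟨by linarith, hbound u⟩)
  refine ⟨-ψ, fun t ht => ?_⟩
  have h1 : ψ (G t) ≤ -ξ t := (hg _).trans (hN t ht)
  rw [neg_apply]
  linarith

/-- A convex cone whose polar is trivial is dense. -/
lemma PointedCone.dense_of_polar_eq_zero {K : PointedCone ℝ X}
    (hK : ∀ φ : StrongDual ℝ X, (∀ k ∈ K, φ k ≤ 0) → φ = 0) : Dense (K : Set X) := by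
  intro x
  by_contra hx
  obtain ⟨φ, u, hφ, hu⟩ := geometric_hahn_banach_closed_point
    (K.toConvexCone.convex.closure) isClosed_closure hx
  have h0 : 0 < u := by simpa using hφ 0 (subset_closure K.zero_mem)
  have hle : ∀ k ∈ K, φ k ≤ 0 := by
    intro k hk
    by_contra! hpos
    have h1 := hφ ((u / φ k) • k)
      (subset_closure (K.smul_mem (by positivity) hk))
    rw [map_smul, smul_eq_mul, div_mul_cancel₀ _ hpos.ne'] at h1
    exact h1.false
  rw [hK φ hle] at hu
  exact (h0.trans hu).false

end Duality

/-! ### Epi-Lipschitz-like sets -/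

section EpiLipschitzLike

variable {E : Type*} [NormedAddCommGroup E] [NormedSpace ℝ E]

/-- Modulo a closed subspace of finite codimension, the unit ball is totally bounded. -/
lemma Submodule.exists_finite_approx {L : Submodule ℝ E} (hL : IsClosed (L : Set E))
    [FiniteDimensional ℝ (E ⧸ L)] {ε : ℝ} (hε : 0 < ε) :
    ∃ A : Set E, A.Finite ∧ ∃ R > (0 : ℝ), ∀ y : E, ‖y‖ ≤ 1 →
      ∃ a ∈ A, ∃ z ∈ L, ‖z‖ ≤ R ∧ ‖y - (a + z)‖ ≤ ε := by
  have : IsClosed (L : Set E) := hL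
  have : ProperSpace (E ⧸ L) := FiniteDimensional.proper ℝ _
  obtain ⟨B, -, hB, hcov⟩ :=
    finite_cover_balls_of_compact (isCompact_closedBall (0 : E ⧸ L) 1) hε
  choose lift hlift using Submodule.Quotient.mk_surjective L
  have hA : (lift '' B).Finite := hB.image _
  obtain ⟨R, hR, hAR⟩ := hA.isBounded.exists_pos_norm_le
  refine ⟨lift '' B, hA, 1 + R + ε, by positivity, fun y hy => ?_⟩
  have hy' : (Submodule.Quotient.mk y : E ⧸ L) ∈ Metric.closedBall (0 : E ⧸ L) 1 := by
    rw [mem_closedBall_zero_iff]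
    exact (Submodule.Quotient.norm_mk_le L y).trans hy
  obtain ⟨b, hb, hyb⟩ := Set.mem_iUnion₂.1 (hcov hy')
  rw [mem_ball_iff_norm] at hyb
  obtain ⟨m, hm, hmε⟩ := Submodule.Quotient.norm_mk_lt
    (Submodule.Quotient.mk y - b : E ⧸ L) (sub_pos.2 hyb)
  rw [add_sub_cancel] at hmε
  refine ⟨lift b, ⟨b, hb, rfl⟩, y - lift b - m, ?_, ?_, ?_⟩
  · rw [← Submodule.Quotient.mk_eq_zero, Submodule.Quotient.mk_sub, Submodule.Quotient.mk_sub, hm,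
      hlift, sub_self]
  · have h1 := norm_sub_le (y - lift b) m
    have h2 := norm_sub_le y (lift b)
    linarith [hAR _ ⟨b, hb, rfl⟩]
  · have : y - (lift b + (y - lift b - m)) = m := by abel
    rw [this]
    exact hmε.le

/-- An epi-Lipschitz-like set has, up to `ε` and finitely many translations, enough bounded
uniformly tangent vectors to fill the unit ball. -/
lemma IsEpiLipschitzLikeAt.exists_isUniformlyTangent {S : Set E} {x₀ : E}
    (h : IsEpiLipschitzLikeAt S x₀) {ε : ℝ} (hε : 0 < ε) :
    ∃ A : Set E, A.Finite ∧ ∃ W : Set E, Bornology.IsBounded W ∧ IsUniformlyTangent W S x₀ ∧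
      ∀ y : E, ‖y‖ ≤ 1 → ∃ a ∈ A, ∃ w ∈ W, ‖y - (a + w)‖ ≤ ε := by
  obtain ⟨δ, hδ, Ω, hΩ, ⟨z, -, L, hL, hfin, u, hu⟩, η, hη, H⟩ := h
  have hLc : IsClosed (L : Set E) := hL ▸ Submodule.isClosed_topologicalClosure _
  have hΩt : IsUniformlyTangent Ω S x₀ := by
    intro ε' hε'
    refine ⟨δ, hδ, η / 2, by positivity, fun d hd x hx t ht => ?_⟩
    refine ⟨d, Metric.mem_closedBall_self hε'.le, ?_⟩
    rcases ht.1.eq_or_lt with rfl | ht0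
    · simpa using hx.1
    · exact H x hx.symm t ⟨ht0, by linarith [ht.2]⟩ d hd
  have hcl : ∀ v : E, v ∈ closedConvexHull ℝ ((fun x => x - z) '' Ω) → z + v ∈ closure Ω := by
    intro v hv
    have hconv : Convex ℝ ((fun x => x - z) '' Ω) := by
      simpa [sub_eq_add_neg, add_comm] using hΩ.translate (-z)
    rw [closedConvexHull_eq_closure_convexHull, hconv.convexHull_eq] at hv
    have := mem_closure_image (f := fun x => z + x) (by fun_prop : ContinuousAt _ v) hv
    simpa [Set.image_image] using this
  obtain ⟨r, hr, hball⟩ := Metric.isOpen_iff.1 isOpen_interior u hu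
  obtain ⟨A, hA, R, hR, hcov⟩ := L.exists_finite_approx hLc hε
  -- `W₀` holds a translate of a ball of `L`; dilating by `s` turns the radius `r / 2` into `R`
  set s : ℝ := R / (r / 2) with hs
  have hs0 : 0 < s := by positivity
  let W₀ : Set E := {w | w ∈ closure Ω ∧ ‖w - (z + u)‖ ≤ r}
  have hW₀ : Bornology.IsBounded W₀ := Metric.isBounded_closedBall.subset
    fun w hw => mem_closedBall_iff_norm.2 hw.2
  refine ⟨(fun a => a - s • (z + u)) '' A, hA.image _, s • W₀, hW₀.smul₀ s,
    (hΩt.closure.mono fun w hw => hw.1).smul hs0.le, fun y hy => ?_⟩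
  obtain ⟨a, ha, v, hvL, hvR, hyav⟩ := hcov y hy
  have hnorm : ‖s⁻¹ • v‖ ≤ r / 2 := by
    rw [norm_smul, norm_inv, Real.norm_of_nonneg hs0.le, inv_mul_le_iff₀ hs0, hs,
      div_mul_cancel₀ _ (by positivity)]
    exact hvR
  have hmem : (u + ⟨s⁻¹ • v, L.smul_mem _ hvL⟩ : L) ∈ Metric.ball u r := by
    rw [mem_ball_iff_norm, add_sub_cancel_left]
    change ‖s⁻¹ • v‖ < r
    linarith
  refine ⟨_, ⟨a, ha, rfl⟩, s • (z + (u + s⁻¹ • v)), ⟨_, ⟨?_, ?_⟩, rfl⟩, ?_⟩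
  · exact hcl _ (interior_subset
      (s := {u : L | (u : E) ∈ closedConvexHull ℝ ((fun x => x - z) '' Ω)}) (hball hmem))
  · have : z + (u + s⁻¹ • v) - (z + u) = s⁻¹ • v := by abel
    rw [this]
    linarith
  · have : (fun a => a - s • (z + ↑u)) a + s • (z + (↑u + s⁻¹ • v)) = a + v := by
      simp only [smul_add, smul_inv_smul₀ hs0.ne']
      abel
    rw [this]
    exact hyav

end EpiLipschitzLike

/-! ### Epigraphs and the sum rule -/

section SumRule

variable {X : Type*} [NormedAddCommGroup X] [NormedSpace ℝ X]

/-- The map `((x, r), (y, s)) ↦ x - y`, whose kernel is the fibre product over `X`. -/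
noncomputable def baseDiff (X : Type*) [NormedAddCommGroup X] [NormedSpace ℝ X] :
    (X × ℝ) × (X × ℝ) →L[ℝ] X :=
  (ContinuousLinearMap.fst ℝ X ℝ).comp (ContinuousLinearMap.fst ℝ _ _) -
    (ContinuousLinearMap.fst ℝ X ℝ).comp (ContinuousLinearMap.snd ℝ _ _)

@[simp]
lemma baseDiff_apply (p q : X × ℝ) : baseDiff X (p, q) = p.1 - q.1 := rfl

lemma dualPair_apply (x' : StrongDual ℝ X) (s : ℝ) (p : X × ℝ) :
    dualPair x' s p = x' p.1 + s * p.2 := by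
  simp [dualPair]

lemma isClosed_epi {Z : Type*} [TopologicalSpace Z] {f : Z → EReal}
    (hf : LowerSemicontinuous f) : IsClosed (epi f) :=
  hf.isClosed_epigraph.preimage
    (continuous_fst.prodMk (continuous_coe_real_ereal.comp continuous_snd))

/-- The qualification condition on the singular subdifferentials says that the projections to `X`
of the two tangent cones have a dense difference. -/
lemma dense_baseDiff_clarkeTangentCone {f₁ f₂ : X → EReal} {x₀ : X}
    (hqual : clarkeSingularSubdifferential f₁ x₀ ∩ (-clarkeSingularSubdifferential f₂ x₀) = {0}) :
    Dense (baseDiff X '' (clarkeTangentCone (epi f₁) (x₀, (f₁ x₀).toReal) ×ˢ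
      clarkeTangentCone (epi f₂) (x₀, (f₂ x₀).toReal))) := by
  set T₁ := clarkeTangentPointedCone (epi f₁) (x₀, (f₁ x₀).toReal)
  set T₂ := clarkeTangentPointedCone (epi f₂) (x₀, (f₂ x₀).toReal)
  refine PointedCone.dense_of_polar_eq_zero
    (K := PointedCone.map (baseDiff X : (X × ℝ) × (X × ℝ) →ₗ[ℝ] X) (Submodule.prod T₁ T₂)) ?_
  intro φ hφ
  have hK : ∀ p ∈ T₁, ∀ q ∈ T₂, φ (p.1 - q.1) ≤ 0 := fun p hp q hq =>
    hφ _ ⟨(p, q), ⟨hp, hq⟩, rfl⟩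
  rw [← Set.mem_singleton_iff, ← hqual]
  refine ⟨fun p hp => ?_, fun q hq => ?_⟩
  · simpa [dualPair_apply] using hK p hp 0 T₂.zero_mem
  · simpa [dualPair_apply] using hK 0 T₁.zero_mem q hq

/-- Under the assumptions of the sum rule, the product of the two epigraphs has a bounded uniformly
tangent set that `baseDiff` maps approximately onto the unit ball. Its first factor is obtained by
adding finitely many tangent vectors to the ones provided by the epi-Lipschitz-like property. -/
lemma exists_isUniformlyTangent_epi_prod {f₁ f₂ : X → EReal} {x₀ : X}
    (hLip : IsLipschitzLikeAt f₁ x₀)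
    (hqual : clarkeSingularSubdifferential f₁ x₀ ∩ (-clarkeSingularSubdifferential f₂ x₀) = {0}) :
    ∃ D₁ D₂ : Set (X × ℝ), Bornology.IsBounded (D₁ ×ˢ D₂) ∧
      IsUniformlyTangent D₁ (epi f₁) (x₀, (f₁ x₀).toReal) ∧
      IsUniformlyTangent D₂ (epi f₂) (x₀, (f₂ x₀).toReal) ∧
      ∀ u : X, ‖u‖ ≤ 1 → ∃ d ∈ D₁ ×ˢ D₂, ‖u - baseDiff X d‖ ≤ 1 / 4 := by
  have hdense := dense_baseDiff_clarkeTangentCone hqual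
  have happrox : ∀ x : X, ∃ p ∈ clarkeTangentCone (epi f₁) (x₀, (f₁ x₀).toReal),
      ∃ q ∈ clarkeTangentCone (epi f₂) (x₀, (f₂ x₀).toReal), ‖x - (p.1 - q.1)‖ ≤ 1 / 8 := by
    intro x
    obtain ⟨_, ⟨⟨p, q⟩, ⟨hp, hq⟩, rfl⟩, h⟩ := hdense.exists_dist_lt x
      (show (0 : ℝ) < 1 / 8 by norm_num)
    exact ⟨p, hp, q, hq, by rw [← dist_eq_norm]; exact h.le⟩
  choose p hp q hq hpq using happrox
  obtain ⟨A, hA, W, hWb, hWt, hcov⟩ :=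
    hLip.exists_isUniformlyTangent (show (0 : ℝ) < 1 / 8 by norm_num)
  have hP : ((fun a : X × ℝ => p a.1) '' A).Finite := hA.image _
  have hQ : ((fun a : X × ℝ => q a.1) '' A).Finite := hA.image _
  refine ⟨(fun a => p a.1) '' A + W, (fun a => q a.1) '' A,
    (hP.isBounded.add hWb).prod hQ.isBounded, ?_, ?_, fun u hu => ?_⟩
  · refine (isUniformlyTangent_of_finite hP ?_).add hWt hP.isBounded
    rintro _ ⟨a, -, rfl⟩
    exact hp _
  · refine isUniformlyTangent_of_finite hQ ?_
    rintro _ ⟨a, -, rfl⟩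
    exact hq _
  · obtain ⟨a, ha, w, hw, haw⟩ := hcov (u, 0) (by simpa [Prod.norm_def] using hu)
    refine ⟨(p a.1 + w, q a.1), ⟨Set.add_mem_add ⟨a, ha, rfl⟩ hw, ⟨a, ha, rfl⟩⟩, ?_⟩
    have h1 : ‖u - (a.1 + w.1)‖ ≤ 1 / 8 := (norm_fst_le ((u, (0 : ℝ)) - (a + w))).trans haw
    have h2 : u - baseDiff X (p a.1 + w, q a.1) =
        (u - (a.1 + w.1)) + (a.1 - ((p a.1).1 - (q a.1).1)) := by
      rw [baseDiff_apply, Prod.fst_add]; abel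
    rw [h2]
    linarith [norm_add_le (u - (a.1 + w.1)) (a.1 - ((p a.1).1 - (q a.1).1)), hpq a.1]

/-- A point of the epigraph of `f₁ + f₂` close to the base point splits into points of the two
epigraphs close to the respective base points. Lower semicontinuity bounds both summands from below,
and therefore each of them from above. -/
lemma exists_split_of_mem_epi_add {Z : Type*} [PseudoMetricSpace Z] {f₁ f₂ : Z → EReal}
    (hf₁ : LowerSemicontinuous f₁) (hf₂ : LowerSemicontinuous f₂)
    (hbot₁ : ∀ x, f₁ x ≠ ⊥) (hbot₂ : ∀ x, f₂ x ≠ ⊥)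
    {x₀ : Z} {a₁ a₂ : ℝ} (ha₁ : f₁ x₀ = a₁) (ha₂ : f₂ x₀ = a₂) {δ : ℝ} (hδ : 0 < δ) :
    ∃ δ' > (0 : ℝ), ∀ z ∈ epi (fun x => f₁ x + f₂ x) ∩ Metric.closedBall (x₀, a₁ + a₂) δ',
      ∃ r₁ r₂ : ℝ, r₁ + r₂ = z.2 ∧
        ((z.1, r₁), (z.1, r₂)) ∈
          (epi f₁ ×ˢ epi f₂) ∩ Metric.closedBall ((x₀, a₁), (x₀, a₂)) δ := by
  have h₁ := hf₁ x₀ ((a₁ - δ / 4 : ℝ) : EReal) (by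
    change _ < f₁ x₀
    rw [ha₁]; exact EReal.coe_lt_coe_iff.2 (by linarith))
  have h₂ := hf₂ x₀ ((a₂ - δ / 4 : ℝ) : EReal) (by
    change _ < f₂ x₀
    rw [ha₂]; exact EReal.coe_lt_coe_iff.2 (by linarith))
  obtain ⟨ρ, hρ, hball⟩ := Metric.eventually_nhds_iff.1 (h₁.and h₂)
  refine ⟨min (ρ / 2) (δ / 4), by positivity, ?_⟩
  rintro ⟨x, r⟩ ⟨hz, hzb⟩
  rw [Metric.mem_closedBall, Prod.dist_eq, max_le_iff, le_min_iff, le_min_iff] at hzb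
  obtain ⟨⟨hxρ, hxδ⟩, -, hrδ⟩ := hzb
  dsimp only at hxρ hxδ hrδ
  obtain ⟨hl₁, hl₂⟩ := hball (show dist x x₀ < ρ by linarith)
  have hsum : f₁ x + f₂ x ≤ (r : EReal) := hz
  have hr : (r : EReal) ≠ ⊤ := EReal.coe_ne_top r
  have ht₁ : f₁ x ≠ ⊤ := fun h => by
    rw [h, EReal.top_add_of_ne_bot (hbot₂ x)] at hsum
    exact hr (top_le_iff.1 hsum)
  have ht₂ : f₂ x ≠ ⊤ := fun h => by
    rw [h, EReal.add_top_of_ne_bot (hbot₁ x)] at hsum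
    exact hr (top_le_iff.1 hsum)
  obtain ⟨u₁, hu₁⟩ : ∃ u : ℝ, f₁ x = u := ⟨_, (EReal.coe_toReal ht₁ (hbot₁ x)).symm⟩
  obtain ⟨u₂, hu₂⟩ : ∃ u : ℝ, f₂ x = u := ⟨_, (EReal.coe_toReal ht₂ (hbot₂ x)).symm⟩
  rw [gt_iff_lt, hu₁, EReal.coe_lt_coe_iff] at hl₁
  rw [gt_iff_lt, hu₂, EReal.coe_lt_coe_iff] at hl₂
  rw [hu₁, hu₂, ← EReal.coe_add, EReal.coe_le_coe_iff] at hsum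
  rw [Real.dist_eq, abs_le] at hrδ
  refine ⟨u₁, r - u₁, by ring, ⟨hu₁.le, ?_⟩, ?_⟩
  · change f₂ x ≤ ((r - u₁ : ℝ) : EReal)
    rw [hu₂, EReal.coe_le_coe_iff]
    linarith
  · simp only [Metric.mem_closedBall, Prod.dist_eq, max_le_iff, Real.dist_eq, abs_le]
    refine ⟨⟨?_, ?_, ?_⟩, ?_, ?_, ?_⟩ <;> linarith

/-- Addition of the last coordinates maps tangent vectors of the fibre product of the two epigraphs
to tangent vectors of the epigraph of the sum. -/
lemma mem_clarkeTangentCone_epi_add {f₁ f₂ : X → EReal} (hf₁ : LowerSemicontinuous f₁)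
    (hf₂ : LowerSemicontinuous f₂) (hbot₁ : ∀ x, f₁ x ≠ ⊥) (hbot₂ : ∀ x, f₂ x ≠ ⊥)
    {x₀ : X} {a₁ a₂ : ℝ} (ha₁ : f₁ x₀ = a₁) (ha₂ : f₂ x₀ = a₂) {p q : X × ℝ}
    (h : (p, q) ∈ clarkeTangentCone ((epi f₁ ×ˢ epi f₂) ∩ {c | baseDiff X c = 0})
      ((x₀, a₁), (x₀, a₂))) :
    (p.1, p.2 + q.2) ∈ clarkeTangentCone (epi fun x => f₁ x + f₂ x) (x₀, a₁ + a₂) := by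
  intro ε hε
  obtain ⟨δ, hδ, l, hl, H⟩ := h (ε / 2) (half_pos hε)
  obtain ⟨δ', hδ', hsplit⟩ := exists_split_of_mem_epi_add hf₁ hf₂ hbot₁ hbot₂ ha₁ ha₂ hδ
  refine ⟨δ', hδ', l, hl, fun z hz t ht => ?_⟩
  obtain ⟨r₁, r₂, hr, hmem, hball⟩ := hsplit z hz
  obtain ⟨⟨⟨w, s₁⟩, ⟨w', s₂⟩⟩, hw, ⟨hw₁, hw₂⟩, hker⟩ := H _ ⟨⟨hmem, sub_self _⟩, hball⟩ t ht
  have hww : z.1 + t • w = z.1 + t • w' := sub_eq_zero.1 hker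
  simp only [Metric.mem_closedBall, Prod.dist_eq, max_le_iff] at hw
  refine ⟨(w, s₁ + s₂), ?_, ?_⟩
  · simp only [Metric.mem_closedBall, Prod.dist_eq, max_le_iff]
    exact ⟨by linarith [hw.1.1], by linarith [dist_add_add_le s₁ s₂ p.2 q.2, hw.1.2, hw.2.2]⟩
  · have h₁ : f₁ (z.1 + t • w) ≤ ((r₁ + t * s₁ : ℝ) : EReal) := hw₁
    have h₂ : f₂ (z.1 + t • w) ≤ ((r₂ + t * s₂ : ℝ) : EReal) := by rw [hww]; exact hw₂
    change f₁ (z.1 + t • w) + f₂ (z.1 + t • w) ≤ ((z.2 + t * (s₁ + s₂) : ℝ) : EReal)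
    have h3 : z.2 + t * (s₁ + s₂) = (r₁ + t * s₁) + (r₂ + t * s₂) := by rw [← hr]; ring
    rw [h3, EReal.coe_add]
    exact add_le_add h₁ h₂

end SumRule

theorem mainTheorem4 {X : Type*} [NormedAddCommGroup X] [NormedSpace ℝ X] [CompleteSpace X]
    (f₁ f₂ : X → EReal)
    (hf₁ : LowerSemicontinuous f₁) (hf₂ : LowerSemicontinuous f₂)
    (hbot₁ : ∀ x, f₁ x ≠ ⊥) (hbot₂ : ∀ x, f₂ x ≠ ⊥)
    (x₀ : X) (hdom₁ : f₁ x₀ ≠ ⊤) (hdom₂ : f₂ x₀ ≠ ⊤)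
    (hLip : IsLipschitzLikeAt f₁ x₀)
    (hqual : clarkeSingularSubdifferential f₁ x₀ ∩ (-clarkeSingularSubdifferential f₂ x₀) = {0}) :
    clarkeSubdifferential (fun x => f₁ x + f₂ x) x₀ ⊆
      clarkeSubdifferential f₁ x₀ + clarkeSubdifferential f₂ x₀ := by
  intro x' hx'
  set a₁ := (f₁ x₀).toReal with ha₁
  set a₂ := (f₂ x₀).toReal with ha₂
  have hfa₁ : f₁ x₀ = a₁ := (EReal.coe_toReal hdom₁ (hbot₁ x₀)).symm
  have hfa₂ : f₂ x₀ = a₂ := (EReal.coe_toReal hdom₂ (hbot₂ x₀)).symm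
  have hsum : (f₁ x₀ + f₂ x₀).toReal = a₁ + a₂ := by
    rw [hfa₁, hfa₂, ← EReal.coe_add, EReal.toReal_coe]
  obtain ⟨D₁, D₂, hb, hD₁, hD₂, hcov⟩ := exists_isUniformlyTangent_epi_prod hLip hqual
  let T₁ := clarkeTangentPointedCone (epi f₁) (x₀, a₁)
  let T₂ := clarkeTangentPointedCone (epi f₂) (x₀, a₂)
  let T : PointedCone ℝ ((X × ℝ) × (X × ℝ)) := Submodule.prod T₁ T₂
  obtain ⟨M, hM⟩ := PointedCone.exists_preimage_norm_le (T := T)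
    ((isClosed_clarkeTangentCone _ _).prod (isClosed_clarkeTangentCone _ _))
    (Set.prod_mono hD₁.subset_clarkeTangentCone hD₂.subset_clarkeTangentCone) hb hcov
  let ξ : StrongDual ℝ ((X × ℝ) × (X × ℝ)) := (dualPair x' (-1)).coprod (dualPair 0 (-1))
  have hξ_apply : ∀ p q : X × ℝ, ξ (p, q) = x' p.1 - p.2 - q.2 := fun p q => by
    simp [ξ, dualPair_apply]; ring
  have hξ : ∀ t ∈ T, baseDiff X t = 0 → ξ t ≤ 0 := by
    rintro ⟨p, q⟩ ⟨hp, hq⟩ hker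
    have hpq : (p, q) ∈ clarkeTangentCone (epi f₁ ×ˢ epi f₂) ((x₀, a₁), (x₀, a₂)) := by
      rw [mem_clarkeTangentCone_iff, ← Set.singleton_prod_singleton]
      exact (mem_clarkeTangentCone_iff.1 hp).prod (mem_clarkeTangentCone_iff.1 hq)
    have hmem := (hD₁.prod hD₂).mem_clarkeTangentCone_inter_ker
      ((isClosed_epi hf₁).prod (isClosed_epi hf₂)) hb hcov hpq hker
    have hle : dualPair x' (-1) (p.1, p.2 + q.2) ≤ 0 := hx' _ (by
      rw [hsum]
      exact mem_clarkeTangentCone_epi_add hf₁ hf₂ hbot₁ hbot₂ hfa₁ hfa₂ hmem)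
    rw [dualPair_apply] at hle
    rw [hξ_apply]
    linarith
  obtain ⟨φ, hφ⟩ := PointedCone.exists_le_comp_of_nonpos_on_ker hM hξ
  refine ⟨x' - φ, fun p hp => ?_, φ, fun q hq => ?_, sub_add_cancel _ _⟩
  · have h := hφ (p, 0) ⟨hp, T₂.zero_mem⟩
    rw [hξ_apply, baseDiff_apply, Prod.fst_zero, Prod.snd_zero, sub_zero, sub_zero] at h
    rw [dualPair_apply, sub_apply]
    linarith
  · have h := hφ (0, q) ⟨T₁.zero_mem, hq⟩
    rw [hξ_apply, baseDiff_apply, Prod.fst_zero, Prod.snd_zero, map_zero, zero_sub, zero_sub,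
      map_neg, neg_zero, zero_sub] at h
    rw [dualPair_apply]
    linarith
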